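/- Let $T:\mathbb{Z}\to\mathbb{Z}$ be the $3x+1$ map, $T(n)=\frac{3n+1}{2}$ for odd $n$ and $T(n)=\frac n2$ for even $n$. For an integer $m\ge 1$ let $\mathcal{O}_1^-(m)=\{n\in\mathbb{Z} : T^{\circ j}(n)=m \text{ for some } j\ge 0\}$ be the backward orbit of $m$, and let $$f_{1,m}(z)=\sum_{n\in\mathcal{O}_1^-(m),\ n\ge 1} z^n\qquad(|z|<1)$$ be its generating function. The $3x+1$ Conjecture is the assertion that for every integer $n\ge 1$ there is $j\ge 0$ with $T^{\circ j}(n)=1$. A function $f$ that is holomorphic in the open unit disk has the unit circle as a natural boundary if no point $\zeta$ with $|\zeta|=1$ has a neighborhood $U$ with a holomorphic function on $U$ that agrees with $f$ on $\{z \in U: |z|<1\}$. (1) For every integer $m\ge 1$ with $m\notin\{1,2,4,8\}$, the function $f_{1,m}$ has the unit circle $\{|z|=1\}$ as a natural boundary. (2) If the $3x+1$ Conjecture is true, then for each $m\in\{1,2,4,8\}$ the function $f_{1,m}$ agrees on the open unit disk with a rational function of $z$ that has no poles there. If the $3x+1$ Conjecture is false, then for each $m\in\{1,2,4,8\}$ the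 function $f_{1,m}$ has the unit circle $\{|z|=1\}$ as a natural boundary. -/

import Mathlib

/-- The `3x+k` map `T_k : ℤ → ℤ`, `n ↦ (3n+k)/2` for odd `n` and `n ↦ n/2` for even `n`.
For odd `k`, in particular for `k = 1`, both divisions are exact. -/
def collatzMap (k n : ℤ) : ℤ := if Even n then n / 2 else (3 * n + k) / 2

/-- The forward orbit `O_k⁺(m) = {n : n = T_k^j(m) for some j ≥ 0}`. -/
def forwardOrbit (k m : ℤ) : Set ℤ := {n | ∃ j : ℕ, n = (collatzMap k)^[j] m}

/-- The backward orbit `O_k⁻(m) = {n : T_k^j(n) = m for some j ≥ 0}`. -/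
def backwardOrbit (k m : ℤ) : Set ℤ := {n | ∃ j : ℕ, (collatzMap k)^[j] n = m}

/-- The `3x+1` Conjecture: the forward orbit under `T_1` of every positive integer contains `1`. -/
def CollatzConjecture : Prop := ∀ m : ℤ, 1 ≤ m → (1 : ℤ) ∈ forwardOrbit 1 m

/-- The backward orbit generating function `f_{k,m}(z) = ∑ zⁿ`, summed over the positive
integers `n` in the backward orbit `O_k⁻(m)`; it is considered on the open unit disk, where the
series converges. -/
noncomputable def orbitGenFun (k m : ℤ) (z : ℂ) : ℂ :=
  ∑' n : {n : ℕ // 0 < n ∧ (n : ℤ) ∈ backwardOrbit k m}, z ^ (n : ℕ)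

/-- The series defining `f_{k,m}` converges absolutely in the open unit disk. -/
theorem summable_orbitGenFun (k m : ℤ) {z : ℂ} (hz : ‖z‖ < 1) :
    Summable fun n : {n : ℕ // 0 < n ∧ (n : ℤ) ∈ backwardOrbit k m} => ‖z ^ (n : ℕ)‖ := by
  have h : Summable fun n : ℕ => ‖z ^ n‖ := by
    simpa [norm_pow] using summable_geometric_of_lt_one (norm_nonneg z) hz
  exact h.subtype _

/-- The unit circle is a natural boundary of `f`: the function `f` is holomorphic in the open unit
disk and no point `ζ` of the unit circle is regular for `f`, i.e. there is no function analytic at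
`ζ` that agrees with `f` at all points of the open unit disk close to `ζ`. -/
def HasUnitCircleNaturalBoundary (f : ℂ → ℂ) : Prop :=
  DifferentiableOn ℂ f (Metric.ball 0 1) ∧
    ∀ ζ : ℂ, ‖ζ‖ = 1 →
      ¬ ∃ g : ℂ → ℂ, AnalyticAt ℂ g ζ ∧ ∀ᶠ z in nhdsWithin ζ (Metric.ball 0 1), g z = f z

/-- On the open unit disk `f` is a rational function `p / q`, with `q` nowhere zero there. -/
def IsRationalOnUnitDisk (f : ℂ → ℂ) : Prop :=
  ∃ p q : Polynomial ℂ, ∀ z : ℂ, ‖z‖ < 1 → q.eval z ≠ 0 ∧ f z = p.eval z / q.eval z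

/-!
The coefficients of `orbitGenFun 1 m` are `0` and `1`. By Szegő's theorem
(`hasUnitCircleNaturalBoundary_of_finite_range`), a power series with finitely many different
coefficients has the unit circle as a natural boundary unless its coefficients are eventually
periodic. It remains to see when the backward orbit of `m` is an eventually periodic set.

*Szegő's theorem.* Suppose that `∑ a_n z^n` continues analytically to a point `ζ` of the unit
circle. If `a` is not eventually periodic, no word length `p` suffices for the last `p` coefficients
to determine the next one (`eventually_periodic_of_words_determine`), so for every `p` there are
positions `n` and `m` preceded by the same `p` coefficients with `a_n ≠ a_m`. The difference of the
tails `∑ a_{n+k} z^k` and `∑ a_{m+k} z^k` continues to a neighbourhood of `ζ`. Outside the unit disk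
it is of size `‖z‖ ^ (-p)`, and near `ζ` it is bounded after multiplication by a quadratic polynomial
(`norm_crossingPoly_mul_shiftedTail_sub_le`). As `p → ∞` it tends to `0` outside the disk, so by
Vitali's theorem also at the points of the disk near `ζ`. A limit of these differences along a
subsequence is a power series that vanishes identically although its constant term is a limit of
nonzero elements of a finite set; this is a contradiction.

*Arithmetic.* Away from `m`, membership in the backward orbit is invariant under `n ↦ 2n` and
`2n+1 ↦ 3n+2`. If it is also eventually periodic, these invariances make `1` a period
(`eventually_iff_succ_of_eventually_periodic`), and the backward orbit contains all large integers,
since it contains all `2^i m`. The trajectory of `2^N n` then shows that every positive `n` leads to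
`m` or is of the form `m / 2^i`. Taking `n = 1` and `n = 5` leaves `m ∈ {1, 2, 4, 8}`, and these `m`
lead to `1`, so the `3x+1` conjecture holds. Conversely, under the conjecture every `n ≥ 5` passes
through `8 → 4 → 2 → 1`, and all but finitely many coefficients are `1`.
-/

/-! ### Power series with bounded coefficients -/

theorem summable_norm_coeff_mul_pow {a : ℕ → ℂ} {C : ℝ} (ha : ∀ n, ‖a n‖ ≤ C) {z : ℂ}
    (hz : ‖z‖ < 1) : Summable fun n => ‖a n * z ^ n‖ := by
  refine Summable.of_nonneg_of_le (fun _ => norm_nonneg _) (fun n => ?_)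
    ((summable_geometric_of_lt_one (norm_nonneg z) hz).mul_left C)
  rw [norm_mul, norm_pow]
  exact mul_le_mul_of_nonneg_right (ha n) (by positivity)

theorem norm_tsum_coeff_mul_pow_le {a : ℕ → ℂ} {C : ℝ} (ha : ∀ n, ‖a n‖ ≤ C) {z : ℂ}
    (hz : ‖z‖ < 1) : ‖∑' n, a n * z ^ n‖ ≤ C / (1 - ‖z‖) := by
  refine tsum_of_norm_bounded
    (by simpa [div_eq_mul_inv] using (hasSum_geometric_of_lt_one (norm_nonneg z) hz).mul_left C)
    fun n => ?_
  rw [norm_mul, norm_pow]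
  exact mul_le_mul_of_nonneg_right (ha n) (by positivity)

theorem differentiableOn_tsum_coeff_mul_pow {a : ℕ → ℂ} {C : ℝ} (ha : ∀ n, ‖a n‖ ≤ C) :
    DifferentiableOn ℂ (fun z => ∑' n, a n * z ^ n) (Metric.ball 0 1) := by
  intro z hz
  rw [mem_ball_zero_iff] at hz
  obtain ⟨t, hzt, ht⟩ := exists_between hz
  have ht0 : 0 ≤ t := (norm_nonneg z).trans hzt.le
  have h : DifferentiableOn ℂ (fun z => ∑' n, a n * z ^ n) (Metric.ball 0 t) := by
    refine Complex.differentiableOn_tsum_of_summable_norm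
      ((summable_geometric_of_lt_one ht0 ht).mul_left C) (fun n => by fun_prop)
      Metric.isOpen_ball fun n w hw => ?_
    rw [mem_ball_zero_iff] at hw
    rw [norm_mul, norm_pow]
    exact mul_le_mul (ha n) (pow_le_pow_left₀ (norm_nonneg _) hw.le n) (by positivity)
      ((norm_nonneg _).trans (ha n))
  exact (h.differentiableAt (Metric.isOpen_ball.mem_nhds (by simpa using hzt))
    ).differentiableWithinAt

/-- A form of Vitali's theorem: a bounded sequence of holomorphic functions on a disk that tends
to `0` uniformly near the centre tends to `0` at every point of the disk. -/
theorem tendsto_zero_of_bounded_of_tendsto_zero_near_center {h : ℕ → ℂ → ℂ} {w : ℂ} {r R K : ℝ}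
    {ε : ℕ → ℝ} (hr : 0 < r) (hrR : r < R) (hd : ∀ p, DifferentiableOn ℂ (h p) (Metric.ball w R))
    (hK : ∀ p, ∀ z ∈ Metric.ball w R, ‖h p z‖ ≤ K)
    (hε : ∀ p, ∀ z ∈ Metric.closedBall w r, ‖h p z‖ ≤ ε p)
    (hε0 : Filter.Tendsto ε Filter.atTop (nhds 0)) {z : ℂ} (hz : z ∈ Metric.ball w R) :
    Filter.Tendsto (fun p => h p z) Filter.atTop (nhds 0) := by
  rw [mem_ball_iff_norm] at hz
  obtain ⟨t, hzt, ht⟩ := exists_between hz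
  have ht0 : 0 < t := (norm_nonneg _).trans_lt hzt
  -- Cauchy's estimates on a circle of radius `s` around `w`.
  have cauchy : ∀ p k s A, 0 < s → s < R → (∀ z ∈ Metric.closedBall w s, ‖h p z‖ ≤ A) →
      ‖((k.factorial : ℂ))⁻¹ • (z - w) ^ k • iteratedDeriv k (h p) w‖
        ≤ A * (‖z - w‖ / s) ^ k := by
    intro p k s A hs hsR hA
    have hcl : Metric.closedBall w s ⊆ Metric.ball w R := Metric.closedBall_subset_ball hsR
    have h1 := Complex.norm_iteratedDeriv_le_of_forall_mem_sphere_norm_le k hs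
      (((hd p).mono hcl).diffContOnCl_ball (subset_refl _))
      (fun z hz => hA z (Metric.sphere_subset_closedBall hz))
    rw [norm_smul, norm_smul, norm_inv, norm_pow, Complex.norm_natCast]
    have hf : (0 : ℝ) < k.factorial := by positivity
    calc (k.factorial : ℝ)⁻¹ * (‖z - w‖ ^ k * ‖iteratedDeriv k (h p) w‖)
        ≤ (k.factorial : ℝ)⁻¹ * (‖z - w‖ ^ k * (k.factorial * A / s ^ k)) := by gcongr
      _ = A * (‖z - w‖ / s) ^ k := by rw [div_pow]; field_simp
  have hsum : ∀ p, h p z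
      = ∑' k : ℕ, ((k.factorial : ℂ))⁻¹ • (z - w) ^ k • iteratedDeriv k (h p) w := fun p =>
    (Complex.hasSum_taylorSeries_on_ball (hd p) (mem_ball_iff_norm.2 hz)).tsum_eq.symm
  simp_rw [hsum]
  have hlt : ‖z - w‖ / t < 1 := (div_lt_one ht0).2 hzt
  have key := tendsto_tsum_of_dominated_convergence (𝓕 := Filter.atTop)
    (f := fun p k => ((k.factorial : ℂ))⁻¹ • (z - w) ^ k • iteratedDeriv k (h p) w)
    (g := fun _ : ℕ => (0 : ℂ))
    ((summable_geometric_of_lt_one (by positivity) hlt).mul_left K)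
    (fun k => by
      refine squeeze_zero_norm (fun p => cauchy p k r (ε p) hr hrR (hε p)) ?_
      simpa using hε0.mul_const ((‖z - w‖ / r) ^ k))
    (Filter.Eventually.of_forall fun p k => cauchy p k t K ht0 ht
      fun z hz => hK p z (Metric.closedBall_subset_ball ht hz))
  simpa using key

/-! ### Tails of a power series continued across the unit circle -/

/-- The value at `z` of `(g - ∑_{k < n} a_k z^k) / z^n`. If `g` is the sum of the power series
`∑ a_k z^k`, this is the sum `∑ a_{n+k} z^k` of the series shifted by `n`. -/
noncomputable def shiftedTail (a : ℕ → ℂ) (g : ℂ → ℂ) (n : ℕ) (z : ℂ) : ℂ :=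
  (g z - ∑ k ∈ Finset.range n, a k * z ^ k) / z ^ n

theorem shiftedTail_eq_tsum {a : ℕ → ℂ} {C : ℝ} (ha : ∀ n, ‖a n‖ ≤ C) {g : ℂ → ℂ} {z : ℂ}
    (hz : ‖z‖ < 1) (hz0 : z ≠ 0) (hg : g z = ∑' k, a k * z ^ k) (n : ℕ) :
    shiftedTail a g n z = ∑' k, a (n + k) * z ^ k := by
  have hs := (summable_norm_coeff_mul_pow ha hz).of_norm
  rw [shiftedTail, hg, ← hs.sum_add_tsum_nat_add n, add_sub_cancel_left,
    div_eq_iff (pow_ne_zero _ hz0), ← tsum_mul_right]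
  refine tsum_congr fun k => ?_
  rw [add_comm k n, pow_add]
  ring

theorem differentiableAt_shiftedTail {a : ℕ → ℂ} {g : ℂ → ℂ} {z : ℂ}
    (hg : DifferentiableAt ℂ g z) (hz : z ≠ 0) (n : ℕ) :
    DifferentiableAt ℂ (shiftedTail a g n) z := by
  unfold shiftedTail
  exact (hg.sub (by fun_prop)).div (by fun_prop) (pow_ne_zero _ hz)

theorem shiftedTail_eq_sum_inv {a : ℕ → ℂ} {g : ℂ → ℂ} {z : ℂ} (hz : z ≠ 0) (n : ℕ) :
    shiftedTail a g n z
      = g z * z⁻¹ ^ n - ∑ k ∈ Finset.range n, a (n - (k + 1)) * z⁻¹ ^ (k + 1) := by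
  rw [shiftedTail, sub_div, div_eq_mul_inv, inv_pow]
  congr 1
  rw [← Finset.sum_range_reflect, Finset.sum_div]
  refine Finset.sum_congr rfl fun k hk => ?_
  have hk' := Finset.mem_range.1 hk
  have h1 : n - 1 - k = n - (k + 1) := by omega
  rw [h1]
  have h2 : z ^ n = z ^ (n - (k + 1)) * z ^ (k + 1) := by rw [← pow_add]; congr 1; omega
  rw [h2, inv_pow]
  field_simp

/-- Outside the closed disk, the difference of two shifted tails whose `p` preceding coefficients
agree is of size `‖z‖ ^ (-p)`. -/
theorem norm_shiftedTail_sub_le {a : ℕ → ℂ} {C M : ℝ} (ha : ∀ n, ‖a n‖ ≤ C) {g : ℂ → ℂ} {z : ℂ}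
    (hz : 1 < ‖z‖) (hM : ‖g z‖ ≤ M) {n m p : ℕ} (hn : p ≤ n) (hm : p ≤ m)
    (hword : ∀ k < p, a (n - (k + 1)) = a (m - (k + 1))) :
    ‖shiftedTail a g n z - shiftedTail a g m z‖
      ≤ (2 * M + 2 * (C / (‖z‖ - 1))) * ‖z‖⁻¹ ^ p := by
  have hzpos : 0 < ‖z‖ := by linarith
  have hz0 : z ≠ 0 := norm_pos_iff.1 hzpos
  have hx0 : 0 < ‖z‖⁻¹ := by positivity
  have hx1 : ‖z‖⁻¹ < 1 := inv_lt_one_of_one_lt₀ hz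
  have hC : 0 ≤ C := (norm_nonneg _).trans (ha 0)
  have hM0 : 0 ≤ M := (norm_nonneg _).trans hM
  have hpow : ∀ n, p ≤ n → ‖g z * z⁻¹ ^ n‖ ≤ M * ‖z‖⁻¹ ^ p := fun n hn => by
    rw [norm_mul, norm_pow, norm_inv]
    exact mul_le_mul hM (pow_le_pow_of_le_one hx0.le hx1.le hn) (by positivity) hM0
  have htail : ∀ n, p ≤ n →
      ‖∑ k ∈ Finset.Ico p n, a (n - (k + 1)) * z⁻¹ ^ (k + 1)‖
        ≤ C / (‖z‖ - 1) * ‖z‖⁻¹ ^ p := fun n hn => by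
    refine (norm_sum_le_of_le _ (f := fun k => a (n - (k + 1)) * z⁻¹ ^ (k + 1))
      (n := fun k => C * ‖z‖⁻¹ * ‖z‖⁻¹ ^ k) fun k _ => ?_).trans ?_
    · rw [norm_mul, norm_pow, norm_inv, pow_succ]
      calc _ ≤ C * (‖z‖⁻¹ ^ k * ‖z‖⁻¹) := by gcongr; exact ha _
        _ = _ := by ring
    · rw [← Finset.mul_sum]
      refine (mul_le_mul_of_nonneg_left (geom_sum_Ico_le_of_lt_one hx0.le hx1)
        (mul_nonneg hC hx0.le)).trans_eq ?_
      have h1 : ‖z‖ - 1 ≠ 0 := by linarith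
      have h2 : 1 - ‖z‖⁻¹ ≠ 0 := by linarith
      have h3 : ‖z‖⁻¹ / (1 - ‖z‖⁻¹) = 1 / (‖z‖ - 1) := by
        rw [div_eq_div_iff h2 h1]
        field_simp
      calc C * ‖z‖⁻¹ * (‖z‖⁻¹ ^ p / (1 - ‖z‖⁻¹))
          = C * (‖z‖⁻¹ / (1 - ‖z‖⁻¹)) * ‖z‖⁻¹ ^ p := by ring
        _ = C / (‖z‖ - 1) * ‖z‖⁻¹ ^ p := by rw [h3]; ring
  have hsplit : ∀ n, p ≤ n → shiftedTail a g n z = g z * z⁻¹ ^ n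
      - (∑ k ∈ Finset.range p, a (n - (k + 1)) * z⁻¹ ^ (k + 1)
        + ∑ k ∈ Finset.Ico p n, a (n - (k + 1)) * z⁻¹ ^ (k + 1)) := fun n hn => by
    rw [shiftedTail_eq_sum_inv hz0, Finset.sum_range_add_sum_Ico _ hn]
  have hcommon : ∑ k ∈ Finset.range p, a (n - (k + 1)) * z⁻¹ ^ (k + 1)
      = ∑ k ∈ Finset.range p, a (m - (k + 1)) * z⁻¹ ^ (k + 1) :=
    Finset.sum_congr rfl fun k hk => by rw [hword k (Finset.mem_range.1 hk)]
  rw [hsplit n hn, hsplit m hm, hcommon]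
  set P := ∑ k ∈ Finset.range p, a (m - (k + 1)) * z⁻¹ ^ (k + 1)
  set U := ∑ k ∈ Finset.Ico p n, a (n - (k + 1)) * z⁻¹ ^ (k + 1)
  set V := ∑ k ∈ Finset.Ico p m, a (m - (k + 1)) * z⁻¹ ^ (k + 1)
  calc ‖g z * z⁻¹ ^ n - (P + U) - (g z * z⁻¹ ^ m - (P + V))‖
      = ‖(g z * z⁻¹ ^ n - g z * z⁻¹ ^ m) - (U - V)‖ := by congr 1; ring
    _ ≤ (‖g z * z⁻¹ ^ n‖ + ‖g z * z⁻¹ ^ m‖) + (‖U‖ + ‖V‖) :=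
        (norm_sub_le _ _).trans (add_le_add (norm_sub_le _ _) (norm_sub_le _ _))
    _ ≤ (M * ‖z‖⁻¹ ^ p + M * ‖z‖⁻¹ ^ p)
        + (C / (‖z‖ - 1) * ‖z‖⁻¹ ^ p + C / (‖z‖ - 1) * ‖z‖⁻¹ ^ p) :=
        add_le_add (add_le_add (hpow n hn) (hpow m hm)) (add_le_add (htail n hn) (htail m hm))
    _ = _ := by ring

/-- A quadratic polynomial that vanishes at the two points where the circle of radius `r` around
a point `ζ` of the unit circle meets the unit circle. -/
noncomputable def crossingPoly (ζ : ℂ) (r : ℝ) (z : ℂ) : ℂ :=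
  (z - ζ) ^ 2 + r ^ 2 * ζ * (z - ζ) + r ^ 2 * ζ ^ 2

theorem norm_crossingPoly {ζ z : ℂ} {r : ℝ} (hζ : ‖ζ‖ = 1) (hz : ‖z - ζ‖ = r) :
    ‖crossingPoly ζ r z‖ = r * |‖z‖ ^ 2 - 1| := by
  -- With `z - ζ = w`, one has `r² = w w̄` and `1 = ζ ζ̄`, and the polynomial is `ζ w (z z̄ - 1)`.
  have h1 : (r : ℂ) ^ 2 = (z - ζ) * (starRingEnd ℂ) (z - ζ) := by
    rw [Complex.mul_conj, Complex.normSq_eq_norm_sq, hz]; push_cast; rfl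
  have h2 : ζ * (starRingEnd ℂ) ζ = 1 := by
    rw [Complex.mul_conj, Complex.normSq_eq_norm_sq, hζ]; simp
  have h3 : z * (starRingEnd ℂ) z = ((‖z‖ ^ 2 : ℝ) : ℂ) := by
    rw [Complex.mul_conj, Complex.normSq_eq_norm_sq]
  have h4 : crossingPoly ζ r z = ζ * (z - ζ) * (((‖z‖ ^ 2 - 1 : ℝ)) : ℂ) := by
    rw [Complex.ofReal_sub, ← h3, crossingPoly, h1, map_sub, Complex.ofReal_one]
    linear_combination (-(z - ζ) * z) * h2
  rw [h4, norm_mul, norm_mul, hζ, hz, Complex.norm_real, Real.norm_eq_abs, one_mul]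

/-- If the tails at `n` and `m` are preceded by the same `p` coefficients, their difference times
`crossingPoly` is bounded on a small disk around `ζ`, uniformly in `n`, `m` and `p`. The poles
`1 / |1 - ‖z‖|` of the estimates inside and outside of the unit disk are cancelled by
`crossingPoly` on the boundary circle, and the maximum principle does the rest. -/
theorem norm_crossingPoly_mul_shiftedTail_sub_le {a : ℕ → ℂ} {C M r : ℝ} (ha : ∀ n, ‖a n‖ ≤ C)
    {g : ℂ → ℂ} {ζ : ℂ} (hζ : ‖ζ‖ = 1) (hr : 0 < r) (hr1 : r < 1)
    (hg : ∀ z ∈ Metric.closedBall ζ r, DifferentiableAt ℂ g z)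
    (hM : ∀ z ∈ Metric.closedBall ζ r, ‖g z‖ ≤ M)
    (hgf : ∀ z ∈ Metric.closedBall ζ r, ‖z‖ < 1 → g z = ∑' k, a k * z ^ k)
    {n m p : ℕ} (hn : p ≤ n) (hm : p ≤ m)
    (hword : ∀ k < p, a (n - (k + 1)) = a (m - (k + 1))) {z : ℂ} (hz : z ∈ Metric.closedBall ζ r) :
    ‖crossingPoly ζ r z * (shiftedTail a g n z - shiftedTail a g m z)‖ ≤ 6 * (M + C) := by
  have hC : 0 ≤ C := (norm_nonneg _).trans (ha 0)
  have hM0 : 0 ≤ M := (norm_nonneg _).trans (hM z hz)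
  have hne : ∀ z ∈ Metric.closedBall ζ r, z ≠ 0 := by
    rintro z hz rfl
    rw [mem_closedBall_iff_norm, zero_sub, norm_neg, hζ] at hz
    linarith
  have hdiff : DiffContOnCl ℂ
      (fun z => crossingPoly ζ r z * (shiftedTail a g n z - shiftedTail a g m z))
      (Metric.ball ζ r) := by
    refine DifferentiableOn.diffContOnCl_ball (U := Metric.closedBall ζ r)
      (fun z hz => DifferentiableAt.differentiableWithinAt ?_) (subset_refl _)
    refine DifferentiableAt.mul (by unfold crossingPoly; fun_prop) ?_
    exact (differentiableAt_shiftedTail (hg z hz) (hne z hz) n).sub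
      (differentiableAt_shiftedTail (hg z hz) (hne z hz) m)
  refine Complex.norm_le_of_forall_mem_frontier_norm_le Metric.isBounded_ball hdiff
    (fun z hz => ?_) (by rwa [closure_ball ζ hr.ne'])
  rw [frontier_ball ζ hr.ne'] at hz
  have hzc := Metric.sphere_subset_closedBall hz
  rw [mem_sphere_iff_norm] at hz
  have hz2 : ‖z‖ ≤ 2 := by
    calc ‖z‖ = ‖(z - ζ) + ζ‖ := by rw [sub_add_cancel]
      _ ≤ ‖z - ζ‖ + ‖ζ‖ := norm_add_le _ _
      _ ≤ 2 := by rw [hz, hζ]; linarith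
  have hzn := norm_nonneg z
  rw [norm_mul, norm_crossingPoly hζ hz]
  rcases lt_trichotomy ‖z‖ 1 with hlt | heq | hgt
  · have h1 : 0 < 1 - ‖z‖ := by linarith
    have hT : ∀ n, ‖shiftedTail a g n z‖ ≤ C / (1 - ‖z‖) := fun n => by
      rw [shiftedTail_eq_tsum ha hlt (hne z hzc) (hgf z hzc hlt)]
      exact norm_tsum_coeff_mul_pow_le (fun k => ha (n + k)) hlt
    have habs : |‖z‖ ^ 2 - 1| = (1 - ‖z‖) * (1 + ‖z‖) := by
      rw [abs_of_nonpos (by nlinarith)]; ring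
    rw [habs]
    calc r * ((1 - ‖z‖) * (1 + ‖z‖)) * ‖shiftedTail a g n z - shiftedTail a g m z‖
        ≤ r * ((1 - ‖z‖) * (1 + ‖z‖)) * (C / (1 - ‖z‖) + C / (1 - ‖z‖)) := by
          gcongr
          exact (norm_sub_le _ _).trans (add_le_add (hT n) (hT m))
      _ = r * (1 + ‖z‖) * (2 * C) := by field_simp; ring
      _ ≤ 1 * (1 + 1) * (2 * C) := by gcongr
      _ ≤ 6 * (M + C) := by linarith
  · rw [heq]
    simp only [one_pow, sub_self, abs_zero, mul_zero, zero_mul]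
    positivity
  · have h1 : 0 < ‖z‖ - 1 := by linarith
    have hb : ‖shiftedTail a g n z - shiftedTail a g m z‖ ≤ 2 * M + 2 * (C / (‖z‖ - 1)) := by
      refine (norm_shiftedTail_sub_le ha hgt (hM z hzc) hn hm hword).trans
        (mul_le_of_le_one_right (by positivity) ?_)
      exact pow_le_one₀ (by positivity) (inv_le_one_of_one_le₀ hgt.le)
    have habs : |‖z‖ ^ 2 - 1| = (‖z‖ - 1) * (1 + ‖z‖) := by
      rw [abs_of_nonneg (by nlinarith)]; ring
    rw [habs]
    calc r * ((‖z‖ - 1) * (1 + ‖z‖)) * ‖shiftedTail a g n z - shiftedTail a g m z‖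
        ≤ r * ((‖z‖ - 1) * (1 + ‖z‖)) * (2 * M + 2 * (C / (‖z‖ - 1))) := by gcongr
      _ = r * (1 + ‖z‖) * (2 * M * (‖z‖ - 1) + 2 * C) := by field_simp
      _ ≤ 1 * (1 + 2) * (2 * M * (2 - 1) + 2 * C) := by gcongr
      _ = 6 * (M + C) := by ring

/-- Right limits of the coefficients of a power series that can be continued analytically across a
boundary point are determined by their past: if the words of length `p` before the positions
`n p` and `m p` agree and the coefficients after these positions have differences converging
to `d`, then `d 0 = 0`. Indeed, the differences of the shifted tails tend to `0` outside the unit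
disk, hence across the regular arc also inside, where they tend to `∑ d_k z^k`. -/
theorem eq_zero_of_analyticAt_of_words_agree {a : ℕ → ℂ} {C : ℝ} (ha : ∀ n, ‖a n‖ ≤ C)
    {g : ℂ → ℂ} {ζ : ℂ} (hζ : ‖ζ‖ = 1) (hg : AnalyticAt ℂ g ζ)
    (hgf : ∀ᶠ z in nhdsWithin ζ (Metric.ball 0 1), g z = ∑' k, a k * z ^ k)
    {n m : ℕ → ℕ} (hn : ∀ p, p ≤ n p) (hm : ∀ p, p ≤ m p)
    (hword : ∀ p, ∀ k < p, a (n p - (k + 1)) = a (m p - (k + 1)))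
    {d : ℕ → ℂ} (hd : ∀ k, Filter.Tendsto (fun p => a (n p + k) - a (m p + k)) Filter.atTop
      (nhds (d k))) : d 0 = 0 := by
  have hC : 0 ≤ C := (norm_nonneg _).trans (ha 0)
  have hζ0 : ζ ≠ 0 := norm_pos_iff.1 (by rw [hζ]; exact one_pos)
  obtain ⟨ρ₁, hρ₁, hgρ⟩ := hg.exists_ball_analyticOnNhd
  obtain ⟨ρ₂, hρ₂, hgf⟩ := Metric.mem_nhdsWithin_iff.1 hgf
  obtain ⟨r, hr, hr'⟩ : ∃ r, 0 < r ∧ r < min (min ρ₁ ρ₂) 1 :=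
    exists_between (lt_min (lt_min hρ₁ hρ₂) one_pos)
  have hr1 : r < 1 := hr'.trans_le (min_le_right _ _)
  have hrρ₁ : r < ρ₁ := hr'.trans_le ((min_le_left _ _).trans (min_le_left _ _))
  have hrρ₂ : r < ρ₂ := hr'.trans_le ((min_le_left _ _).trans (min_le_right _ _))
  have hgd : ∀ z ∈ Metric.closedBall ζ r, DifferentiableAt ℂ g z := fun z hz =>
    (hgρ z (Metric.closedBall_subset_ball hrρ₁ hz)).differentiableAt
  have hgf' : ∀ z ∈ Metric.closedBall ζ r, ‖z‖ < 1 → g z = ∑' k, a k * z ^ k :=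
    fun z hz hz1 => hgf ⟨Metric.closedBall_subset_ball hrρ₂ hz, by simpa using hz1⟩
  obtain ⟨M, hM⟩ := (isCompact_closedBall ζ r).exists_bound_of_continuousOn
    (fun z hz => (hgd z hz).continuousAt.continuousWithinAt)
  have hM0 : 0 ≤ M := (norm_nonneg _).trans (hM ζ (Metric.mem_closedBall_self hr.le))
  have hne : ∀ z ∈ Metric.closedBall ζ r, z ≠ 0 := by
    rintro z hz rfl
    rw [mem_closedBall_iff_norm, zero_sub, norm_neg, hζ] at hz
    linarith
  set h : ℕ → ℂ → ℂ := fun p z =>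
    crossingPoly ζ r z * (shiftedTail a g (n p) z - shiftedTail a g (m p) z) with hh
  have hcross : Differentiable ℂ (crossingPoly ζ r) := by unfold crossingPoly; fun_prop
  have hbound : ∀ p, ∀ z ∈ Metric.closedBall ζ r, ‖h p z‖ ≤ 6 * (M + C) := fun p z hz =>
    norm_crossingPoly_mul_shiftedTail_sub_le ha hζ hr hr1 hgd hM hgf' (hn p) (hm p) (hword p) hz
  -- A disk around a point `w` outside the unit disk that reaches into the unit disk.
  set w : ℂ := ζ * (1 + r / 4 : ℝ) with hw
  have hwζ : ‖w - ζ‖ = r / 4 := by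
    have : w - ζ = ζ * (r / 4 : ℝ) := by rw [hw]; push_cast; ring
    rw [this, norm_mul, hζ, one_mul, Complex.norm_real, Real.norm_of_nonneg (by positivity)]
  have hwn : ‖w‖ = 1 + r / 4 := by
    rw [hw, norm_mul, hζ, one_mul, Complex.norm_real, Real.norm_of_nonneg (by positivity)]
  have hsub : Metric.ball w (r / 2) ⊆ Metric.closedBall ζ r := fun z hz => by
    rw [mem_ball_iff_norm] at hz
    rw [mem_closedBall_iff_norm]
    have := norm_add_le (z - w) (w - ζ)
    rw [sub_add_sub_cancel] at this
    linarith
  have hdiff : ∀ p, DifferentiableOn ℂ (h p) (Metric.ball w (r / 2)) := fun p z hz =>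
    (hcross.differentiableAt.mul
      ((differentiableAt_shiftedTail (hgd z (hsub hz)) (hne z (hsub hz)) _).sub
        (differentiableAt_shiftedTail (hgd z (hsub hz)) (hne z (hsub hz)) _))
      ).differentiableWithinAt
  obtain ⟨A, hA⟩ := (isCompact_closedBall ζ r).exists_bound_of_continuousOn
    hcross.continuous.continuousOn
  have hA0 : 0 ≤ A := (norm_nonneg _).trans (hA ζ (Metric.mem_closedBall_self hr.le))
  have hsmall : ∀ p, ∀ z ∈ Metric.closedBall w (r / 8),
      ‖h p z‖ ≤ A * (2 * M + 2 * (C / (r / 8))) * (1 + r / 8)⁻¹ ^ p := fun p z hz => by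
    have hzc : z ∈ Metric.closedBall ζ r :=
      hsub (Metric.closedBall_subset_ball (by linarith) hz)
    have hzn : 1 + r / 8 ≤ ‖z‖ := by
      rw [mem_closedBall_iff_norm] at hz
      have := norm_sub_norm_le w z
      rw [norm_sub_rev] at this
      linarith
    have h1 := norm_shiftedTail_sub_le ha (by linarith : 1 < ‖z‖) (hM z hzc) (hn p) (hm p)
      (hword p)
    rw [hh, norm_mul, mul_assoc]
    refine mul_le_mul (hA z hzc) (h1.trans ?_) (norm_nonneg _) hA0
    gcongr
    linarith
  have hε0 : Filter.Tendsto
      (fun p : ℕ => A * (2 * M + 2 * (C / (r / 8))) * (1 + r / 8)⁻¹ ^ p) Filter.atTop (nhds 0) := by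
    rw [← mul_zero (A * (2 * M + 2 * (C / (r / 8))))]
    exact (tendsto_pow_atTop_nhds_zero_of_lt_one (by positivity)
      (inv_lt_one_of_one_lt₀ (by linarith))).const_mul _
  have hlim0 : ∀ z ∈ Metric.ball w (r / 2),
      Filter.Tendsto (fun p => h p z) Filter.atTop (nhds 0) := fun z hz =>
    tendsto_zero_of_bounded_of_tendsto_zero_near_center (by positivity) (by linarith) hdiff
      (fun p z hz => hbound p z (hsub hz)) hsmall hε0 hz
  -- Inside the unit disk, the limit is `∑ d_k z^k` times `crossingPoly`.
  have hd2 : ∀ k, ‖d k‖ ≤ 2 * C := fun k =>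
    le_of_tendsto (hd k).norm (Filter.Eventually.of_forall fun p =>
      (norm_sub_le _ _).trans (by linarith [ha (n p + k), ha (m p + k)]))
  have hlim : ∀ z ∈ Metric.closedBall ζ r, ‖z‖ < 1 → Filter.Tendsto (fun p => h p z) Filter.atTop
      (nhds (crossingPoly ζ r z * ∑' k, d k * z ^ k)) := fun z hz hz1 => by
    refine Filter.Tendsto.const_mul _ ?_
    have heq : ∀ p, shiftedTail a g (n p) z - shiftedTail a g (m p) z
        = ∑' k, (a (n p + k) - a (m p + k)) * z ^ k := fun p => by
      rw [shiftedTail_eq_tsum ha hz1 (hne z hz) (hgf' z hz hz1),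
        shiftedTail_eq_tsum ha hz1 (hne z hz) (hgf' z hz hz1),
        ← (summable_norm_coeff_mul_pow (fun k => ha (n p + k)) hz1).of_norm.tsum_sub
          (summable_norm_coeff_mul_pow (fun k => ha (m p + k)) hz1).of_norm]
      simp_rw [sub_mul]
    simp_rw [heq]
    refine tendsto_tsum_of_dominated_convergence
      ((summable_geometric_of_lt_one (norm_nonneg z) hz1).mul_left (2 * C))
      (fun k => (hd k).mul_const _) (Filter.Eventually.of_forall fun p k => ?_)
    rw [norm_mul, norm_pow]
    refine mul_le_mul_of_nonneg_right ?_ (by positivity)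
    exact (norm_sub_le _ _).trans (by linarith [ha (n p + k), ha (m p + k)])
  set z₀ : ℂ := ζ * (1 - r / 8 : ℝ) with hz₀
  have hz₀1 : z₀ ∈ Metric.ball (0 : ℂ) 1 := by
    rw [mem_ball_zero_iff, hz₀, norm_mul, hζ, one_mul, Complex.norm_real,
      Real.norm_of_nonneg (by linarith)]
    linarith
  have hz₀w : z₀ ∈ Metric.ball w (r / 2) := by
    have : z₀ - w = ζ * (-(3 * r / 8) : ℝ) := by rw [hz₀, hw]; push_cast; ring
    rw [mem_ball_iff_norm, this, norm_mul, hζ, one_mul, Complex.norm_real, norm_neg,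
      Real.norm_of_nonneg (by positivity)]
    linarith
  have hG : AnalyticOnNhd ℂ (fun z => crossingPoly ζ r z * ∑' k, d k * z ^ k)
      (Metric.ball 0 1) :=
    (hcross.differentiableOn.mul (differentiableOn_tsum_coeff_mul_pow hd2)).analyticOnNhd
      Metric.isOpen_ball
  have hzero := hG.eqOn_zero_of_preconnected_of_eventuallyEq_zero
    (convex_ball (0 : ℂ) 1).isPreconnected hz₀1 (by
      filter_upwards [Metric.isOpen_ball.mem_nhds hz₀1, Metric.isOpen_ball.mem_nhds hz₀w]
        with z hz1 hzw
      exact tendsto_nhds_unique (hlim z (hsub hzw) (by simpa using hz1)) (hlim0 z hzw))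
  have h0 := hzero (Metric.mem_ball_self one_pos)
  have hsum0 : ∑' k, d k * (0 : ℂ) ^ k = d 0 := by
    rw [tsum_eq_single 0 fun k hk => by simp [hk]]
    simp
  have hc0 : crossingPoly ζ r 0 = ζ ^ 2 := by unfold crossingPoly; ring
  simp only [hsum0, hc0, Pi.zero_apply, mul_eq_zero, pow_eq_zero_iff two_ne_zero] at h0
  exact h0.resolve_left hζ0

/-! ### Szegő's theorem -/

/-- If the words of some length `p` determine the next letter, a sequence with finitely many values
is eventually periodic. -/
theorem eventually_periodic_of_words_determine {α : Type*} {a : ℕ → α} (ha : (Set.range a).Finite)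
    {p : ℕ} (hp : ∀ n m, p ≤ n → p ≤ m → (∀ k < p, a (n - (k + 1)) = a (m - (k + 1))) →
      a n = a m) :
    ∃ N T, 0 < T ∧ ∀ n, N ≤ n → a (n + T) = a n := by
  have := ha.to_subtype
  obtain ⟨n, m, hne, heq⟩ := Finite.exists_ne_map_eq_of_infinite
    (fun n (k : Fin p) => (⟨a (n + k), Set.mem_range_self _⟩ : Set.range a))
  wlog hlt : n < m generalizing n m
  · exact this m n hne.symm heq.symm (by omega)
  have hfirst : ∀ k < p, a (n + k) = a (m + k) := fun k hk =>
    congrArg Subtype.val (congrFun heq ⟨k, hk⟩)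
  have hall : ∀ k, a (n + k) = a (m + k) := by
    intro k
    induction k using Nat.strong_induction_on with
    | _ k ih =>
      by_cases hk : k < p
      · exact hfirst k hk
      · refine hp _ _ (by omega) (by omega) fun i hi => ?_
        have := ih (k - (i + 1)) (by omega)
        rwa [← Nat.add_sub_assoc (by omega), ← Nat.add_sub_assoc (by omega)] at this
  refine ⟨n, m - n, by omega, fun i hi => ?_⟩
  have := hall (i - n)
  rw [show n + (i - n) = i by omega, show m + (i - n) = i + (m - n) by omega] at this
  exact this.symm

/-- **Szegő's theorem**: a power series whose coefficients take finitely many values and are not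
eventually periodic has the unit circle as a natural boundary. -/
theorem hasUnitCircleNaturalBoundary_of_finite_range {a : ℕ → ℂ} (ha : (Set.range a).Finite)
    (hper : ¬ ∃ N T, 0 < T ∧ ∀ n, N ≤ n → a (n + T) = a n) :
    HasUnitCircleNaturalBoundary (fun z => ∑' n, a n * z ^ n) := by
  obtain ⟨C, hC⟩ := ha.isBounded.exists_norm_le
  replace hC : ∀ n, ‖a n‖ ≤ C := fun n => hC _ (Set.mem_range_self n)
  refine ⟨differentiableOn_tsum_coeff_mul_pow hC, ?_⟩
  rintro ζ hζ ⟨g, hg, hgf⟩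
  have hwords : ∀ p : ℕ, ∃ n m, p ≤ n ∧ p ≤ m ∧
      (∀ k < p, a (n - (k + 1)) = a (m - (k + 1))) ∧ a n ≠ a m := by
    by_contra! hcon
    obtain ⟨p, hp⟩ := hcon
    exact hper (eventually_periodic_of_words_determine ha hp)
  choose n m hn hm hword hnm using hwords
  -- The differences of the coefficients lie in a finite set, so a subsequence converges
  -- coefficientwise.
  have hD : (Set.image2 (fun x y => x - y) (Set.range a) (Set.range a)).Finite := ha.image2 _ ha
  obtain ⟨d, -, φ, hφ, hlim⟩ := (isCompact_univ_pi fun _ : ℕ => hD.isCompact).tendsto_subseq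
    (x := fun p k => a (n p + k) - a (m p + k))
    (fun p k _ => Set.mem_image2_of_mem (Set.mem_range_self _) (Set.mem_range_self _))
  have hlim' : ∀ k, Filter.Tendsto (fun p => a (n (φ p) + k) - a (m (φ p) + k)) Filter.atTop
      (nhds (d k)) := fun k => (tendsto_pi_nhds.1 hlim) k
  have hd0 : d 0 = 0 := eq_zero_of_analyticAt_of_words_agree hC hζ hg hgf
    (n := n ∘ φ) (m := m ∘ φ) (fun p => (hφ.id_le p).trans (hn _))
    (fun p => (hφ.id_le p).trans (hm _))
    (fun p k hk => hword _ k (hk.trans_le (hφ.id_le p))) hlim'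
  -- The differences at the positions themselves lie in a finite set of nonzero numbers, which is
  -- closed, so their limit is not zero.
  have hmem := (hD.subset (Set.sdiff_subset (t := {0}))).isClosed.mem_of_tendsto (hlim' 0)
    (Filter.Eventually.of_forall fun p =>
      ⟨Set.mem_image2_of_mem (Set.mem_range_self _) (Set.mem_range_self _),
        sub_ne_zero.2 (hnm (φ p))⟩)
  exact hmem.2 hd0

/-! ### Eventually periodic sets invariant under the `3x+1` map -/

theorem iff_two_pow_mul {s : ℕ → Prop} {K : ℕ} (h : ∀ n, K ≤ n → (s (2 * n) ↔ s n)) (e : ℕ) :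
    ∀ n, K ≤ n → (s (2 ^ e * n) ↔ s n) := by
  intro n hn
  induction e with
  | zero => simp
  | succ e ih =>
    rw [pow_succ', mul_assoc, h _ (hn.trans (Nat.le_mul_of_pos_left n (by positivity))), ih]

theorem iff_add_mul_period {s : ℕ → Prop} {N R : ℕ} (h : ∀ n, N ≤ n → (s (n + R) ↔ s n)) (k : ℕ) :
    ∀ n, N ≤ n → (s (n + k * R) ↔ s n) := by
  intro n hn
  induction k with
  | zero => simp
  | succ k ih => rw [Nat.succ_mul, ← Nat.add_assoc, h _ (by omega), ih]

/-- An eventually periodic set that is eventually invariant under `n ↦ 2n` and under the accelerated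
step `2n+1 ↦ 3n+2` is finite or cofinite. The invariance removes the factors `2` and `3` from the
period; then `6` is invertible modulo the period, and `6y+1 = 3(2y)+1` and `6y+2 = 2(3y+1)` both
lead to `y`, so that `1` is a period. -/
theorem eventually_iff_succ_of_eventually_periodic {s : ℕ → Prop} {K N T : ℕ}
    (h2 : ∀ n, K ≤ n → (s (2 * n) ↔ s n)) (h3 : ∀ n, K ≤ n → (s (3 * n + 2) ↔ s (2 * n + 1)))
    (hT : 0 < T) (hper : ∀ n, N ≤ n → (s (n + T) ↔ s n)) :
    ∃ L, ∀ n, L ≤ n → (s (n + 1) ↔ s n) := by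
  -- The odd part `Q` of the period is a period.
  obtain ⟨e, Q, hQ2, rfl⟩ := Nat.exists_eq_pow_mul_and_not_dvd hT.ne' 2 (by norm_num)
  have hQ : ∀ n, K + N ≤ n → (s (n + Q) ↔ s n) := fun n hn => by
    have hle : n ≤ 2 ^ e * n := Nat.le_mul_of_pos_left n (by positivity)
    rw [← iff_two_pow_mul h2 e (n + Q) (by omega), mul_add, hper _ (by omega),
      iff_two_pow_mul h2 e n (by omega)]
  -- For odd `n` the invariance under `n ↦ 3n+1` is immediate; an even `n` is moved by `Q`.
  have hodd : ∀ n, 2 * K + 1 ≤ n → n % 2 = 1 → (s (3 * n + 1) ↔ s n) := fun n hn hn2 => by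
    obtain ⟨y, rfl⟩ : ∃ y, n = 2 * y + 1 := ⟨n / 2, by omega⟩
    rw [show 3 * (2 * y + 1) + 1 = 2 * (3 * y + 2) by ring, h2 _ (by omega), h3 _ (by omega)]
  have hA : ∀ n, 2 * K + N + 1 ≤ n → (s (3 * n + 1) ↔ s n) := fun n hn => by
    rcases Nat.mod_two_eq_zero_or_one n with hn2 | hn2
    · rw [← hQ n (by omega), ← hodd (n + Q) (by omega) (by omega),
        ← iff_add_mul_period hQ 3 (3 * n + 1) (by omega)]
      ring_nf
    · exact hodd n (by omega) hn2
  -- The part `R` of `Q` prime to `3` is a period.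
  obtain ⟨b, R, hR3, rfl⟩ := Nat.exists_eq_pow_mul_and_not_dvd (n := Q) (by omega) 3 (by norm_num)
  have hR2 : ¬ 2 ∣ R := fun h => hQ2 (h.mul_left _)
  have hAle : ∀ i n, n ≤ (fun n => 3 * n + 1)^[i] n := fun i n => by
    induction i with
    | zero => simp
    | succ i ih => rw [Function.iterate_succ_apply']; omega
  have hAb : ∀ i n, 2 * K + N + 1 ≤ n → (s ((fun n => 3 * n + 1)^[i] n) ↔ s n) := fun i n hn => by
    induction i with
    | zero => simp
    | succ i ih => rw [Function.iterate_succ_apply', hA _ (hn.trans (hAle i n)), ih]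
  have hAadd : ∀ i n, (fun n => 3 * n + 1)^[i] (n + R) = (fun n => 3 * n + 1)^[i] n + 3 ^ i * R :=
    fun i n => by
      induction i with
      | zero => simp
      | succ i ih => rw [Function.iterate_succ_apply', Function.iterate_succ_apply', ih]; ring
  have hR : ∀ n, 2 * K + N + 1 ≤ n → (s (n + R) ↔ s n) := fun n hn => by
    have := hAle b n
    rw [← hAb b (n + R) (by omega), hAadd, hQ _ (by omega), hAb b n hn]
  -- Since `R² ≡ 1` modulo `6`, the class of `z` modulo `R` contains a number `6y+1`.
  obtain ⟨t, ht⟩ : ∃ t, R * R = 6 * t + 1 := by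
    refine ⟨R * R / 6, ?_⟩
    have h : R % 6 = 1 ∨ R % 6 = 5 := by omega
    have h' : R * R % 6 = 1 := by rcases h with h | h <;> simp [Nat.mul_mod, h]
    omega
  refine ⟨2 * K + N + 1, fun z hz => ?_⟩
  set y := z + (5 * z + 1) * t with hy
  have hk : z + ((5 * z + 1) * R) * R = 6 * y + 1 := by
    rw [mul_assoc, ht, hy]; ring
  have hyz : z ≤ y := Nat.le_add_right _ _
  have e1 : s z ↔ s y := by
    rw [← iff_add_mul_period hR ((5 * z + 1) * R) z hz, hk,
      show 6 * y + 1 = 3 * (2 * y) + 1 by ring, hA _ (by omega), h2 _ (by omega)]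
  have e2 : s (z + 1) ↔ s y := by
    rw [← iff_add_mul_period hR ((5 * z + 1) * R) (z + 1) (by omega), add_right_comm, hk,
      show 6 * y + 1 + 1 = 2 * (3 * y + 1) by ring, h2 _ (by omega), hA _ (by omega)]
  rw [e1, e2]

/-! ### Backward orbits of the `3x+1` map -/

theorem collatzMap_two_mul (k n : ℤ) : collatzMap k (2 * n) = n := by
  simp [collatzMap]

theorem collatzMap_one_two_mul_add_one (n : ℤ) : collatzMap 1 (2 * n + 1) = 3 * n + 2 := by
  rw [collatzMap, if_neg (by simp)]
  omega

theorem iterate_collatzMap_two_pow_mul (k : ℤ) (i : ℕ) (n : ℤ) :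
    (collatzMap k)^[i] (2 ^ i * n) = n := by
  induction i with
  | zero => simp
  | succ i ih => rw [Function.iterate_succ_apply, pow_succ', mul_assoc, collatzMap_two_mul, ih]

theorem self_mem_backwardOrbit (k m : ℤ) : m ∈ backwardOrbit k m := ⟨0, rfl⟩

theorem mem_backwardOrbit_of_collatzMap_mem {k m n : ℤ} (h : collatzMap k n ∈ backwardOrbit k m) :
    n ∈ backwardOrbit k m := by
  obtain ⟨j, hj⟩ := h
  exact ⟨j + 1, by rwa [Function.iterate_succ_apply]⟩

theorem mem_backwardOrbit_trans {k l m n : ℤ} (h : n ∈ backwardOrbit k l)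
    (h' : l ∈ backwardOrbit k m) : n ∈ backwardOrbit k m := by
  obtain ⟨i, rfl⟩ := h
  obtain ⟨j, rfl⟩ := h'
  exact ⟨j + i, Function.iterate_add_apply _ _ _ _⟩

theorem collatzMap_mem_backwardOrbit_iff {k m n : ℤ} (hn : n ≠ m) :
    collatzMap k n ∈ backwardOrbit k m ↔ n ∈ backwardOrbit k m := by
  refine ⟨mem_backwardOrbit_of_collatzMap_mem, ?_⟩
  rintro ⟨j, hj⟩
  cases j with
  | zero => exact absurd hj hn
  | succ j => exact ⟨j, by rwa [Function.iterate_succ_apply] at hj⟩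

theorem mem_of_mem_backwardOrbit {k m n : ℤ} {s : Set ℤ} (hs : Set.MapsTo (collatzMap k) s s)
    (hn : n ∈ s) (h : n ∈ backwardOrbit k m) : m ∈ s := by
  obtain ⟨j, rfl⟩ := h
  exact hs.iterate j hn

theorem collatzConjecture_iff : CollatzConjecture ↔ ∀ n : ℤ, 1 ≤ n → n ∈ backwardOrbit 1 1 :=
  forall₂_congr fun _ _ => exists_congr fun _ => eq_comm

/-- The points `8 → 4 → 2 → 1` lie on one trajectory. -/
theorem eight_mem_backwardOrbit {m : ℤ} (hm : m = 1 ∨ m = 2 ∨ m = 4 ∨ m = 8) :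
    (8 : ℤ) ∈ backwardOrbit 1 m := by
  rcases hm with rfl | rfl | rfl | rfl
  · exact ⟨3, iterate_collatzMap_two_pow_mul 1 3 1⟩
  · exact ⟨2, iterate_collatzMap_two_pow_mul 1 2 2⟩
  · exact ⟨1, iterate_collatzMap_two_pow_mul 1 1 4⟩
  · exact self_mem_backwardOrbit 1 8

theorem collatzMap_one_one : collatzMap 1 1 = 2 := collatzMap_one_two_mul_add_one 0

theorem one_mem_backwardOrbit_of_dvd_eight {n : ℤ} (hn : 1 ≤ n) (h : n ∣ 8) :
    n ∈ backwardOrbit 1 1 := by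
  have hle := Int.le_of_dvd (by norm_num) h
  have hcases : n = 1 ∨ n = 2 ∨ n = 4 ∨ n = 8 := by interval_cases n <;> omega
  rcases hcases with rfl | rfl | rfl | rfl
  · exact self_mem_backwardOrbit 1 1
  · exact ⟨1, iterate_collatzMap_two_pow_mul 1 1 1⟩
  · exact ⟨2, iterate_collatzMap_two_pow_mul 1 2 1⟩
  · exact ⟨3, iterate_collatzMap_two_pow_mul 1 3 1⟩

/-- If the backward orbit of `m` contains all large integers, every positive `n` leads to `m`, or
`n` is obtained from `m` by repeated halving: consider the trajectory of `2 ^ N * n`. -/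
theorem mem_backwardOrbit_or_two_pow_mul_eq {k m : ℤ} {N : ℕ}
    (hN : ∀ n : ℕ, N ≤ n → (n : ℤ) ∈ backwardOrbit k m) {n : ℤ} (hn : 1 ≤ n) :
    n ∈ backwardOrbit k m ∨ ∃ i : ℕ, 2 ^ i * n = m := by
  lift n to ℕ using zero_le_one.trans hn
  have hn0 : 0 < n := by omega
  have hle : N ≤ 2 ^ N * n :=
    Nat.lt_two_pow_self.le.trans (Nat.le_mul_of_pos_right _ hn0)
  obtain ⟨j, hj⟩ := hN _ hle
  push_cast at hj
  rcases le_total N j with h | h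
  · left
    refine ⟨j - N, ?_⟩
    rw [← hj]
    nth_rw 2 [← Nat.sub_add_cancel h]
    rw [Function.iterate_add_apply, iterate_collatzMap_two_pow_mul]
  · right
    refine ⟨N - j, ?_⟩
    rw [← hj, ← Nat.add_sub_cancel' h, pow_add, mul_assoc, iterate_collatzMap_two_pow_mul,
      Nat.add_sub_cancel_left]

/-- Testing the numbers `1` and `5` shows that only the backward orbits of `1`, `2`, `4` and `8` can
be cofinite. -/
theorem eq_of_cofinite_backwardOrbit {m : ℤ} {N : ℕ}
    (hN : ∀ n : ℕ, N ≤ n → (n : ℤ) ∈ backwardOrbit 1 m) :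
    m = 1 ∨ m = 2 ∨ m = 4 ∨ m = 8 := by
  have hT1 := collatzMap_one_one
  have hT2 : collatzMap 1 2 = 1 := collatzMap_two_mul 1 1
  have hT4 : collatzMap 1 4 = 2 := collatzMap_two_mul 1 2
  have hT8 : collatzMap 1 8 = 4 := collatzMap_two_mul 1 4
  have hT5 : collatzMap 1 5 = 8 := collatzMap_one_two_mul_add_one 2
  have h5 : ∀ l : ℕ, ¬ (5 : ℤ) ∣ 2 ^ l := fun l h => by
    have := Int.Prime.dvd_pow' (by norm_num : Nat.Prime 5) h
    omega
  rcases mem_backwardOrbit_or_two_pow_mul_eq hN le_rfl with h1 | ⟨l, hl⟩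
  · have := mem_of_mem_backwardOrbit (s := {1, 2})
      (by rintro x (rfl | rfl) <;> simp [hT1, hT2]) (by simp) h1
    simp only [Set.mem_insert_iff, Set.mem_singleton_iff] at this
    tauto
  · rw [mul_one] at hl
    rcases mem_backwardOrbit_or_two_pow_mul_eq hN (by norm_num : (1 : ℤ) ≤ 5) with h | ⟨i, hi⟩
    · have := mem_of_mem_backwardOrbit (s := {1, 2, 4, 8, 5})
        (by rintro x (rfl | rfl | rfl | rfl | rfl) <;> simp [hT1, hT2, hT4, hT8, hT5]) (by simp) h
      simp only [Set.mem_insert_iff, Set.mem_singleton_iff] at this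
      rcases this with h | h | h | h | h
      any_goals tauto
      exact absurd ⟨1, by rw [hl, h]; rfl⟩ (h5 l)
    · exact absurd ⟨2 ^ i, by rw [hl, ← hi, mul_comm]⟩ (h5 l)

theorem collatzConjecture_of_cofinite_backwardOrbit {m : ℤ} {N : ℕ}
    (hN : ∀ n : ℕ, N ≤ n → (n : ℤ) ∈ backwardOrbit 1 m) : CollatzConjecture := by
  have hm := eq_of_cofinite_backwardOrbit hN
  have hm8 : m ∣ 8 := by rcases hm with rfl | rfl | rfl | rfl <;> norm_num
  have hm1 : 1 ≤ m := by omega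
  refine collatzConjecture_iff.2 fun n hn => ?_
  rcases mem_backwardOrbit_or_two_pow_mul_eq hN hn with h | ⟨i, hi⟩
  · exact mem_backwardOrbit_trans h (one_mem_backwardOrbit_of_dvd_eight hm1 hm8)
  · exact one_mem_backwardOrbit_of_dvd_eight hn ((Dvd.intro_left _ hi).trans hm8)

/-- The only way into the cycle `1 → 2 → 1` from outside is `8 → 4 → 2`. -/
theorem eight_mem_of_mem_backwardOrbit_one {n : ℤ} (h : n ∈ backwardOrbit 1 1) :
    n = 1 ∨ n = 2 ∨ n = 4 ∨ n ∈ backwardOrbit 1 8 := by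
  obtain ⟨j, hj⟩ := h
  induction j generalizing n with
  | zero => exact Or.inl hj
  | succ j ih =>
    rw [Function.iterate_succ_apply] at hj
    have hpre : ∀ c, collatzMap 1 n = c → n = 2 * c ∨ 3 * n + 1 = 2 * c := fun c hc => by
      rcases Int.even_or_odd' n with ⟨y, rfl | rfl⟩
      · rw [collatzMap_two_mul] at hc; omega
      · rw [collatzMap_one_two_mul_add_one] at hc; omega
    rcases ih hj with h | h | h | h
    · have := hpre _ h; omega
    · have := hpre _ h; omega
    · have := hpre _ h
      have h8 : n = 8 := by omega
      exact Or.inr (Or.inr (Or.inr (h8 ▸ self_mem_backwardOrbit 1 8)))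
    · exact Or.inr (Or.inr (Or.inr (mem_backwardOrbit_of_collatzMap_mem h)))

theorem mem_backwardOrbit_of_collatzConjecture (hC : CollatzConjecture) {m : ℤ}
    (hm : m = 1 ∨ m = 2 ∨ m = 4 ∨ m = 8) {n : ℤ} (hn : 5 ≤ n) : n ∈ backwardOrbit 1 m := by
  rcases eight_mem_of_mem_backwardOrbit_one (collatzConjecture_iff.1 hC n (by omega))
    with h | h | h | h
  any_goals omega
  exact mem_backwardOrbit_trans h (eight_mem_backwardOrbit hm)

/-! ### The generating functions of backward orbits -/

/-- The coefficients of `orbitGenFun k m`: the indicator sequence of the positive integers in the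
backward orbit of `m`. -/
noncomputable def orbitCoeff (k m : ℤ) : ℕ → ℂ :=
  Set.indicator {n : ℕ | 0 < n ∧ (n : ℤ) ∈ backwardOrbit k m} 1

theorem orbitGenFun_eq (k m : ℤ) : orbitGenFun k m = fun z => ∑' n, orbitCoeff k m n * z ^ n := by
  funext z
  refine (tsum_subtype {n : ℕ | 0 < n ∧ (n : ℤ) ∈ backwardOrbit k m} fun n => z ^ n).trans
    (tsum_congr fun n => ?_)
  unfold orbitCoeff Set.indicator
  split_ifs <;> simp

theorem orbitCoeff_eq_iff {k m : ℤ} {n l : ℕ} (hn : 0 < n) (hl : 0 < l) :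
    orbitCoeff k m n = orbitCoeff k m l ↔
      ((n : ℤ) ∈ backwardOrbit k m ↔ (l : ℤ) ∈ backwardOrbit k m) := by
  unfold orbitCoeff Set.indicator
  by_cases h1 : (n : ℤ) ∈ backwardOrbit k m <;> by_cases h2 : (l : ℤ) ∈ backwardOrbit k m <;>
    simp [hn, hl, h1, h2]

theorem cofinite_backwardOrbit_of_eventually_periodic {m : ℤ} (hm : 1 ≤ m)
    (h : ∃ N T, 0 < T ∧ ∀ n, N ≤ n → orbitCoeff 1 m (n + T) = orbitCoeff 1 m n) :
    ∃ N : ℕ, ∀ n : ℕ, N ≤ n → (n : ℤ) ∈ backwardOrbit 1 m := by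
  obtain ⟨N, T, hT, hper⟩ := h
  obtain ⟨L, hL⟩ := eventually_iff_succ_of_eventually_periodic
    (s := fun n : ℕ => (n : ℤ) ∈ backwardOrbit 1 m) (K := m.toNat + 1) (N := N + 1) (T := T)
    (fun n hn => by
      rw [← collatzMap_mem_backwardOrbit_iff (by omega : ((2 * n : ℕ) : ℤ) ≠ m), Nat.cast_mul,
        Nat.cast_ofNat, collatzMap_two_mul])
    (fun n hn => by
      rw [← collatzMap_mem_backwardOrbit_iff (by omega : ((2 * n + 1 : ℕ) : ℤ) ≠ m)]
      push_cast
      rw [collatzMap_one_two_mul_add_one])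
    hT (fun n hn => (orbitCoeff_eq_iff (by omega) (by omega)).1 (hper n (by omega)))
  have hconst : ∀ i, ((L + i : ℕ) : ℤ) ∈ backwardOrbit 1 m ↔ ((L : ℕ) : ℤ) ∈ backwardOrbit 1 m :=
    fun i => by
      induction i with
      | zero => simp
      | succ i ih => rw [← ih]; exact hL (L + i) (by omega)
  -- The backward orbit is unbounded since it contains all `2 ^ i * m`.
  have hLmem : ((L : ℕ) : ℤ) ∈ backwardOrbit 1 m := by
    have hle : L ≤ 2 ^ L * m.toNat :=
      Nat.lt_two_pow_self.le.trans (Nat.le_mul_of_pos_right _ (by omega))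
    rw [← hconst (2 ^ L * m.toNat - L), Nat.add_sub_cancel' hle]
    push_cast
    rw [Int.toNat_of_nonneg (by omega)]
    exact ⟨L, iterate_collatzMap_two_pow_mul 1 L m⟩
  refine ⟨L, fun n hn => ?_⟩
  rw [← Nat.add_sub_cancel' hn]
  exact (hconst _).2 hLmem

theorem finite_range_orbitCoeff (k m : ℤ) : (Set.range (orbitCoeff k m)).Finite := by
  refine (Set.toFinite {0, 1}).subset ?_
  rintro _ ⟨n, rfl⟩
  unfold orbitCoeff Set.indicator
  split_ifs <;> simp

theorem hasUnitCircleNaturalBoundary_orbitGenFun {m : ℤ} (hm : 1 ≤ m)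
    (h : ¬ ∃ N : ℕ, ∀ n : ℕ, N ≤ n → (n : ℤ) ∈ backwardOrbit 1 m) :
    HasUnitCircleNaturalBoundary (orbitGenFun 1 m) := by
  rw [orbitGenFun_eq]
  exact hasUnitCircleNaturalBoundary_of_finite_range (finite_range_orbitCoeff 1 m)
    fun hper => h (cofinite_backwardOrbit_of_eventually_periodic hm hper)

theorem isRationalOnUnitDisk_of_eventually_one {a : ℕ → ℂ} {N : ℕ} (ha : ∀ n, N ≤ n → a n = 1) :
    IsRationalOnUnitDisk (fun z => ∑' n, a n * z ^ n) := by
  refine ⟨(∑ n ∈ Finset.range N, Polynomial.C (a n) * Polynomial.X ^ n) * (1 - Polynomial.X)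
    + Polynomial.X ^ N, 1 - Polynomial.X, fun z hz => ?_⟩
  have hz1 : 1 - z ≠ 0 := fun h => by
    rw [← sub_eq_zero.1 h, norm_one] at hz
    exact lt_irrefl _ hz
  have htail : ∀ n, a (n + N) * z ^ (n + N) = z ^ n * z ^ N := fun n => by
    rw [ha _ (by omega), one_mul, pow_add]
  have hs : Summable fun n => a n * z ^ n := by
    rw [← summable_nat_add_iff N]
    simp_rw [htail]
    exact (summable_geometric_of_norm_lt_one hz).mul_right _
  refine ⟨by simpa using hz1, ?_⟩
  beta_reduce
  rw [← hs.sum_add_tsum_nat_add N]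
  simp_rw [htail]
  rw [tsum_mul_right, tsum_geometric_of_norm_lt_one hz]
  simp only [Polynomial.eval_add, Polynomial.eval_mul, Polynomial.eval_finsetSum,
    Polynomial.eval_C, Polynomial.eval_pow, Polynomial.eval_X, Polynomial.eval_sub,
    Polynomial.eval_one]
  field_simp

theorem theorem1p2 :
    (∀ m : ℤ, 1 ≤ m → m ≠ 1 → m ≠ 2 → m ≠ 4 → m ≠ 8 →
      HasUnitCircleNaturalBoundary (orbitGenFun 1 m)) ∧
    (CollatzConjecture →
      ∀ m : ℤ, (m = 1 ∨ m = 2 ∨ m = 4 ∨ m = 8) → IsRationalOnUnitDisk (orbitGenFun 1 m)) ∧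
    (¬ CollatzConjecture →
      ∀ m : ℤ, (m = 1 ∨ m = 2 ∨ m = 4 ∨ m = 8) →
        HasUnitCircleNaturalBoundary (orbitGenFun 1 m)) := by
  refine ⟨fun m hm h1 h2 h4 h8 => ?_, fun hC m hm => ?_, fun hC m hm => ?_⟩
  · refine hasUnitCircleNaturalBoundary_orbitGenFun hm fun ⟨N, hN⟩ => ?_
    have := eq_of_cofinite_backwardOrbit hN
    tauto
  · rw [orbitGenFun_eq]
    refine isRationalOnUnitDisk_of_eventually_one (N := 5) fun n hn => ?_
    exact Set.indicator_of_mem (s := {n : ℕ | 0 < n ∧ (n : ℤ) ∈ backwardOrbit 1 m})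
      ⟨by omega, mem_backwardOrbit_of_collatzConjecture hC hm (by omega)⟩ 1
  · exact hasUnitCircleNaturalBoundary_orbitGenFun (by omega) fun ⟨N, hN⟩ =>
      hC (collatzConjecture_of_cofinite_backwardOrbit hN)
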